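/- Let $\Omega$ be a set, $z_0\in\Omega$, and let $\mathcal E$ be a separable complex Hilbert space. A normalized complete Nevanlinna–Pick (CNP) kernel is a positive definite function $s:\Omega\times\Omega\to\mathbb C$, $s_w(z)=s(z,w)$, of the form $$s_w(z)=\frac1{1-\sum_{n\ge1}u_n(z)\overline{u_n(w)}},\qquad u_n:\Omega\to\mathbb C,\quad u_n(z_0)=0 \text{ for all } n,\quad \sum_n|u_n(z)|^2<\infty \text{ for all } z;$$ in particular $s_{z_0}=1$. Let $s$ be such a kernel and let $k_w(z)=s_w(z)\,g_w(z)$ with $g:\Omega\times\Omega\to\mathbb C$ positive definite. Let $\mathcal H_s$ be the Hilbert space of functions on $\Omega$ with reproducing kernel $s$, and let $\mathcal H_k(\mathcal E)$ be the Hilbert space of $\mathcal E$-valued functions on $\Omega$ with reproducing kernel $k_w(z)I_{\mathcal E}$. For spaces $\mathcal H,\mathcal K$ of functions on $\Omega$, $\mathrm{Mult}(\mathcal H,\mathcal K)$ is the set of $\Phi$ such that $f\mapsto\Phi f$ (pointwise product) defines a bounded operator $\mathcal H\to\mathcal K$, and $\mathrm{Mult}(\mathcal H)=\mathrm{Mult}(\mathcal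 H,\mathcal H)$. Inner products are linear in the first variable. (i) For $F:\Omega\to\mathcal E$ the following are equivalent: (a) $F\in\mathcal H_k(\mathcal E)$ and $\|F\|_{\mathcal H_k(\mathcal E)}\le1$; (b) there are a scalar function $\psi\in\mathrm{Mult}(\mathcal H_s)$ with $\psi(z_0)=0$ and an $\mathcal E$-valued function $\Phi\in\mathrm{Mult}(\mathcal H_s,\mathcal H_k(\mathcal E))$ such that $$\|\psi h\|^2_{\mathcal H_s}+\|\Phi h\|^2_{\mathcal H_k(\mathcal E)}\le\|h\|^2_{\mathcal H_s}\quad\text{for all }h\in\mathcal H_s,$$ and $F(z)=\frac1{1-\psi(z)}\Phi(z)$ for all $z\in\Omega$ (here $1-\psi$ automatically has no zeros). (ii) If $F\in\mathcal H_k(\mathcal E)$ and $\|F\|_{\mathcal H_k(\mathcal E)}=1$, then the pair $(\psi,\Phi)$ in (b) is unique. Moreover, for every $z\in\Omega$ the scalar function $s_z$ is in $\mathrm{Mult}(\mathcal H_k(\mathcal E))$, and if $V_F(z)=2\langle F,s_zF\rangle_{\mathcal H_k(\mathcal E)}-1$ for $z\in\Omega$, then $\mathrm{Re}\,V_F\ge0$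 on $\Omega$ and (b) holds with $$\psi=\frac{V_F-1}{V_F+1},\qquad\Phi=\frac2{V_F+1}F.$$ -/

import Mathlib

open scoped ComplexOrder ComplexConjugate

noncomputable section

namespace CNP

/-- `s z w` stands for `s_w(z)`. A kernel on `Ω` is a normalized complete Nevanlinna-Pick kernel
with normalization point `z₀` if it is positive definite and has the form
`s_w(z) = 1 / (1 - ∑ n, u_n(z) conj (u_n(w)))`, where each `(u_n(z))_n` is square summable (so that
`u(z)` is a bounded row operator `ℓ² → ℂ`) and `u_n(z₀) = 0` for all `n`.
(`1 - ∑ ≠ 0` only says that the fraction is a genuine one.) -/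
def IsNormalizedCNP {Ω : Type*} (z₀ : Ω) (s : Ω → Ω → ℂ) : Prop :=
  (Matrix.of s).PosSemidef ∧
  ∃ u : ℕ → Ω → ℂ,
    (∀ n, u n z₀ = 0) ∧
    (∀ z, Summable fun n => ‖u n z‖ ^ 2) ∧
    ∀ z w, 1 - ∑' n, u n z * conj (u n w) ≠ 0 ∧
      s z w = 1 / (1 - ∑' n, u n z * conj (u n w))

variable {Ω : Type*}
  {V : Type*} [NormedAddCommGroup V] [InnerProductSpace ℂ V]
  {W : Type*} [NormedAddCommGroup W] [InnerProductSpace ℂ W]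

/-- `H` is the space `H_κ(V)`: the Hilbert space of `V`-valued functions on `Ω` whose reproducing
kernel is `(z, w) ↦ κ_w(z) I_V`. For `V = ℂ` this is the scalar space `H_κ`. -/
def HasScalarKernel (H : Type*) [NormedAddCommGroup H] [InnerProductSpace ℂ H] [CompleteSpace H]
    [CompleteSpace V] [RKHS ℂ H Ω V] (κ : Ω → Ω → ℂ) : Prop :=
  ∀ z w, RKHS.kernel H z w = κ z w • ContinuousLinearMap.id ℂ V

section Multipliers

variable (H : Type*) [NormedAddCommGroup H] [InnerProductSpace ℂ H] [RKHS ℂ H Ω V]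
  (K : Type*) [NormedAddCommGroup K] [InnerProductSpace ℂ K] [RKHS ℂ K Ω W]

/-- `Mult(H, K)`: the operator-valued functions `Φ` for which `(M_Φ f)(z) = Φ(z) f(z)` defines a
bounded operator `M_Φ : H → K`. -/
def Mult : Set (Ω → V →L[ℂ] W) :=
  {Φ | ∃ M : H →L[ℂ] K, ∀ (f : H) (z : Ω), M f z = Φ z (f z)}

open Classical in
/-- The multiplication operator `M_Φ : H → K` of a multiplier `Φ ∈ Mult(H, K)`
(and `0` if `Φ` is not a multiplier). -/
def mulOp (Φ : Ω → V →L[ℂ] W) : H →L[ℂ] K :=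
  if h : Φ ∈ Mult H K then h.choose else 0

variable {H K} in
theorem mulOp_apply {Φ : Ω → V →L[ℂ] W} (h : Φ ∈ Mult H K) (f : H) (z : Ω) :
    mulOp H K Φ f z = Φ z (f z) := by
  have e : mulOp H K Φ = h.choose := dif_pos h
  rw [e]
  exact h.choose_spec f z

end Multipliers

/-- A scalar function, viewed as the operator-valued function `z ↦ ψ(z) I_V`. -/
def scalarSymbol (V : Type*) [NormedAddCommGroup V] [InnerProductSpace ℂ V] (ψ : Ω → ℂ) :
    Ω → V →L[ℂ] V :=
  fun z => ψ z • ContinuousLinearMap.id ℂ V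

/-- A `V`-valued function, viewed as the function with values in `B(ℂ, V)`, `Φ(z) a = a • Φ(z)`. -/
def columnSymbol (Φ : Ω → V) : Ω → ℂ →L[ℂ] V :=
  fun z => ContinuousLinearMap.toSpanSingleton ℂ (Φ z)

/-- The pair `(ψ, Φ)` is a factorization of `F` of the kind considered: `ψ ∈ Mult(H_s)`,
`ψ(z₀) = 0`, `Φ ∈ Mult(H_s, H_k(E))`, `‖ψ h‖² + ‖Φ h‖² ≤ ‖h‖²` for all `h ∈ H_s`, and
`F = Φ / (1 - ψ)` on `Ω`. -/
structure IsFactorization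
    (Hs : Type*) [NormedAddCommGroup Hs] [InnerProductSpace ℂ Hs] [RKHS ℂ Hs Ω ℂ]
    (HkE : Type*) [NormedAddCommGroup HkE] [InnerProductSpace ℂ HkE] [RKHS ℂ HkE Ω V]
    (z₀ : Ω) (F : Ω → V) (ψ : Ω → ℂ) (Φ : Ω → V) : Prop where
  mult_left : scalarSymbol ℂ ψ ∈ Mult Hs Hs
  base_point : ψ z₀ = 0
  mult_right : columnSymbol Φ ∈ Mult Hs HkE
  norm_le : ∀ h : Hs, ‖mulOp Hs Hs (scalarSymbol ℂ ψ) h‖ ^ 2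
    + ‖mulOp Hs HkE (columnSymbol Φ) h‖ ^ 2 ≤ ‖h‖ ^ 2
  eq_div : ∀ z, F z = (1 / (1 - ψ z)) • Φ z

/-- The Sarason function `V_F(z) = 2 ⟨F, s_z F⟩ - 1`, the inner product being linear in `F`
and conjugate linear in `s_z F` (Mathlib's `inner` is conjugate linear in its first argument). -/
def sarason {H : Type*} [NormedAddCommGroup H] [InnerProductSpace ℂ H] [RKHS ℂ H Ω V]
    (s : Ω → Ω → ℂ) (F : H) (z : Ω) : ℂ :=
  2 * inner ℂ (mulOp H H (scalarSymbol V fun x => s x z) F) F - 1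

end CNP

end

namespace CNP

/-! ### Gram matrices and contractions between Hilbert spaces -/

section Gram

variable {I H G : Type*} [NormedAddCommGroup H] [InnerProductSpace ℂ H]
  [NormedAddCommGroup G] [InnerProductSpace ℂ G]

/-! Write `s = 1 / (1 - p)` with `p` positive definite, so that `k = p k + g`. A pair `(ψ, Φ)`
satisfies the norm inequality exactly when `1 - T T*` is positive for the column `T = (M_ψ, M_Φ)`,
and testing on kernel functions turns this into positivity of `defectKernel`.

Given a factorization, write the defect kernel as a Gram matrix of vectors `v`. On suitable indices
it collapses to the kernel of `H_k(E)`, which gives an isometry `V` with `V* γ = F` for the unit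
vector `γ = v (z₀, 1, 0)`; hence `‖F‖ ≤ 1`. If `‖F‖ = 1`, then `V F = γ`, and this forces `(1 -
ψ(w)) ⟨F, s_w F⟩ = 1`: uniqueness (`IsFactorization.exists_realization`).

Conversely, `k = p k + g` makes multiplication by `p_w` a strict contraction, so `s_w = (1 - p_w)⁻¹`
is a multiplier and `2 Re ⟨F, s_w F⟩ ≥ ‖F‖²` (`exists_mul_kernel`). Thus `A(w) = ⟨F, s_w F⟩ + 1 -
‖F‖²` has no zeros, and `ψ = 1 - 1/A`, `Φ = F/A` has a positive defect kernel
(`posSemidef_defectKernel`). -/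

theorem inner_self_eq_ofReal (x : H) : inner ℂ x x = ((‖x‖ ^ 2 : ℝ) : ℂ) := by
  rw [inner_self_eq_norm_sq_to_K]
  push_cast
  rfl

/-- The quadratic form of a Gram matrix is the squared norm of the linear combination. -/
theorem finsupp_sum_gram (v : I → H) (x : I →₀ ℂ) :
    (x.sum fun i xi => x.sum fun j xj => star xi * inner ℂ (v i) (v j) * xj)
      = ((‖Finsupp.linearCombination ℂ v x‖ ^ 2 : ℝ) : ℂ) := by
  rw [← inner_self_eq_ofReal, Finsupp.linearCombination_apply, Finsupp.sum_inner]
  refine Finsupp.sum_congr fun i _ => ?_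
  rw [Finsupp.inner_sum]
  refine Finsupp.sum_congr fun j _ => ?_
  simp only [inner_smul_left, inner_smul_right, RCLike.star_def]
  ring

theorem finsupp_sum_gram_sub (v : I → H) (b : I → G) (x : I →₀ ℂ) :
    (x.sum fun i xi => x.sum fun j xj =>
        star xi * (inner ℂ (v i) (v j) - inner ℂ (b i) (b j)) * xj)
      = ((‖Finsupp.linearCombination ℂ v x‖ ^ 2 - ‖Finsupp.linearCombination ℂ b x‖ ^ 2 : ℝ) : ℂ) := by
  rw [Complex.ofReal_sub, ← finsupp_sum_gram, ← finsupp_sum_gram, ← Finsupp.sum_sub]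
  refine Finsupp.sum_congr fun i _ => ?_
  rw [← Finsupp.sum_sub]
  refine Finsupp.sum_congr fun j _ => ?_
  ring

theorem posSemidef_inner (v : I → H) :
    (Matrix.of fun i j => inner ℂ (v i) (v j)).PosSemidef := by
  refine ⟨by ext i j; simp [Matrix.conjTranspose_apply], fun x => ?_⟩
  simp only [Matrix.of_apply]
  rw [finsupp_sum_gram]
  exact_mod_cast sq_nonneg (‖Finsupp.linearCombination ℂ v x‖)

/-- A contraction decreases Gram matrices. -/
theorem posSemidef_inner_sub (v : I → H) (T : H →L[ℂ] G) (hT : ∀ x, ‖T x‖ ≤ ‖x‖) :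
    (Matrix.of fun i j => inner ℂ (v i) (v j) - inner ℂ (T (v i)) (T (v j))).PosSemidef := by
  refine ⟨by ext i j; simp [Matrix.conjTranspose_apply], fun x => ?_⟩
  simp only [Matrix.of_apply]
  rw [finsupp_sum_gram_sub v fun i => T (v i)]
  have e : Finsupp.linearCombination ℂ (fun i => T (v i)) x
      = T (Finsupp.linearCombination ℂ v x) := by
    simp [Finsupp.linearCombination_apply, Finsupp.sum, map_sum]
  rw [e]
  have h := hT (Finsupp.linearCombination ℂ v x)
  have : (0 : ℝ) ≤ ‖Finsupp.linearCombination ℂ v x‖ ^ 2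
      - ‖T (Finsupp.linearCombination ℂ v x)‖ ^ 2 := by
    have := pow_le_pow_left₀ (norm_nonneg _) h 2
    linarith
  exact_mod_cast this

theorem posSemidef_conj_mul (d : I → ℂ) :
    (Matrix.of fun i j => conj (d i) * d j).PosSemidef := by
  have := posSemidef_inner d
  simpa [mul_comm] using this

/-- If the Gram matrix of `b` is dominated by the Gram matrix of a total family `v`, then there is
a contraction that maps `v` to `b`. -/
theorem exists_contraction [CompleteSpace H] [CompleteSpace G] (v : I → H) (b : I → G)
    (hv : ∀ x : H, (∀ i, inner ℂ (v i) x = 0) → x = 0)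
    (h : (Matrix.of fun i j => inner ℂ (v i) (v j) - inner ℂ (b i) (b j)).PosSemidef) :
    ∃ T : H →L[ℂ] G, (∀ x, ‖T x‖ ≤ ‖x‖) ∧ ∀ i, T (v i) = b i := by
  have hle : ∀ x : I →₀ ℂ, ‖Finsupp.linearCombination ℂ b x‖
      ≤ 1 * ‖Finsupp.linearCombination ℂ v x‖ := fun x => by
    have h1 := h.2 x
    simp only [Matrix.of_apply] at h1
    rw [finsupp_sum_gram_sub] at h1
    have h2 : (0 : ℝ) ≤ _ := Complex.zero_le_real.1 h1
    rw [one_mul]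
    exact abs_le_of_sq_le_sq' (by linarith) (norm_nonneg _) |>.2
  have hd : DenseRange (Finsupp.linearCombination ℂ v) := by
    have : (LinearMap.range (Finsupp.linearCombination ℂ v)).topologicalClosure = ⊤ := by
      rw [Submodule.topologicalClosure_eq_top_iff, Submodule.eq_bot_iff]
      intro x hx
      refine hv x fun i => ?_
      refine (Submodule.mem_orthogonal _ _).1 hx _ ⟨Finsupp.single i 1, by simp⟩
    have h2 := Submodule.dense_iff_topologicalClosure_eq_top.2 this
    exact h2
  refine ⟨(Finsupp.linearCombination ℂ b).extendOfNorm (Finsupp.linearCombination ℂ v),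
    fun x => ?_, fun i => ?_⟩
  · simpa using LinearMap.norm_extendOfNorm_apply_le (f := Finsupp.linearCombination ℂ b) hd 1 hle x
  · have := LinearMap.extendOfNorm_eq (f := Finsupp.linearCombination ℂ b) hd ⟨1, hle⟩
      (Finsupp.single i 1)
    simpa using this

theorem norm_adjoint_apply_le [CompleteSpace H] [CompleteSpace G] {T : H →L[ℂ] G}
    (hT : ∀ x, ‖T x‖ ≤ ‖x‖) (y : G) : ‖ContinuousLinearMap.adjoint T y‖ ≤ ‖y‖ := by
  have h1 : ‖ContinuousLinearMap.adjoint T‖ ≤ 1 := by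
    rw [LinearIsometryEquiv.norm_map]
    exact T.opNorm_le_bound zero_le_one (by simpa using hT)
  simpa using (ContinuousLinearMap.adjoint T).le_of_opNorm_le h1 y

/-- Every positive semidefinite kernel is the Gram matrix of a family in a Hilbert space. -/
theorem exists_gram.{w} {J : Type w} {K : J → J → ℂ} (hK : (Matrix.of K).PosSemidef) :
    ∃ (G : Type w) (_ : NormedAddCommGroup G) (_ : InnerProductSpace ℂ G) (_ : CompleteSpace G)
      (v : J → G), ∀ i j, inner ℂ (v i) (v j) = K i j := by
  let K' : Matrix J J (ℂ →L[ℂ] ℂ) := Matrix.of fun i j => K i j • 1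
  have hK' : K'.PosSemidef := by
    refine (RKHS.posSemidef_tfae.out 0 2).mpr ?_
    refine ⟨?_, fun x => ?_⟩
    · ext i j
      have := congr_fun (congr_fun hK.1 i) j
      simp only [Matrix.conjTranspose_apply, Matrix.of_apply] at this
      simp [K', Matrix.conjTranspose_apply, ← this]
    · have := hK.2 x
      have h2 := (Complex.le_def.1 this).1
      simp only [Matrix.of_apply] at h2
      refine h2.trans_eq ?_
      rw [← Complex.conj_re]
      simp only [Finsupp.sum, map_sum]
      rw [Finset.sum_comm]
      simp only [RCLike.re_to_complex, Complex.re_sum]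
      refine Finset.sum_congr rfl fun i _ => Finset.sum_congr rfl fun j _ => ?_
      congr 1
      simp [K']
      ring
  have : Fact K'.PosSemidef := ⟨hK'⟩
  refine ⟨RKHS.OfKernel K', inferInstance, inferInstance, inferInstance,
    fun i => RKHS.kerFun (RKHS.OfKernel K') i 1, fun i j => ?_⟩
  rw [RKHS.kerFun_inner, RKHS.kerFun_apply, RKHS.OfKernel.kernel_ofKernel]
  simp [K']

end Gram

/-! ### Kernel functions of the spaces with scalar kernel -/

section Kernel

variable {Ω V H : Type*} [NormedAddCommGroup V] [InnerProductSpace ℂ V] [CompleteSpace V]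
  [NormedAddCommGroup H] [InnerProductSpace ℂ H] [CompleteSpace H] [RKHS ℂ H Ω V]
  {κ : Ω → Ω → ℂ}

theorem HasScalarKernel.kerFun_apply (hκ : HasScalarKernel H κ) (z w : Ω) (e : V) :
    RKHS.kerFun H w e z = κ z w • e := by
  rw [RKHS.kerFun_apply, hκ z w]
  rfl

theorem HasScalarKernel.inner_kerFun (hκ : HasScalarKernel H κ) (z w : Ω) (e f : V) :
    inner ℂ (RKHS.kerFun H z e) (RKHS.kerFun H w f) = κ z w * inner ℂ e f := by
  rw [RKHS.kerFun_inner, hκ.kerFun_apply, inner_smul_right]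

theorem eq_zero_of_inner_kerFun {x : H} (hx : ∀ z e, inner ℂ (RKHS.kerFun H z e) x = 0) :
    x = 0 := by
  refine RKHS.ext fun z => ext_inner_left ℂ fun e => ?_
  rw [← RKHS.kerFun_inner, hx z e]
  simp

end Kernel

/-! ### Column multipliers and their defect kernel -/

section Column

variable {Ω E : Type*} [NormedAddCommGroup E] [InnerProductSpace ℂ E]

/-- The adjoint of the column multiplier `(M_ψ, M_Φ)` maps `(a s_w, k_w e)` to this multiple of
`s_w`, where `j = (w, a, e)`. -/
noncomputable def adjointCoeff (ψ : Ω → ℂ) (Φ : Ω → E) (j : Ω × ℂ × E) : ℂ :=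
  conj (ψ j.1) * j.2.1 + inner ℂ (Φ j.1) j.2.2

theorem adjointCoeff_base {ψ : Ω → ℂ} {Φ : Ω → E} {z₀ : Ω} (hψ : ψ z₀ = 0) :
    adjointCoeff ψ Φ (z₀, 1, 0) = 0 := by
  simp [adjointCoeff, hψ]

/-- The kernel of `1 - T T*` for the column multiplier `T = (M_ψ, M_Φ) : H_s → H_s ⊕ H_k(E)`. -/
noncomputable def defectKernel (s k : Ω → Ω → ℂ) (ψ : Ω → ℂ) (Φ : Ω → E) (i j : Ω × ℂ × E) : ℂ :=
  s i.1 j.1 * (conj i.2.1 * j.2.1 - conj (adjointCoeff ψ Φ i) * adjointCoeff ψ Φ j)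
    + k i.1 j.1 * inner ℂ i.2.2 j.2.2

variable [CompleteSpace E]
  {Hs : Type*} [NormedAddCommGroup Hs] [InnerProductSpace ℂ Hs] [CompleteSpace Hs]
  [RKHS ℂ Hs Ω ℂ]
  {HkE : Type*} [NormedAddCommGroup HkE] [InnerProductSpace ℂ HkE] [CompleteSpace HkE]
  [RKHS ℂ HkE Ω E]
  {s k : Ω → Ω → ℂ} {ψ : Ω → ℂ} {Φ : Ω → E}

variable (Hs HkE) in
/-- The pair of kernel functions `(a s_w, k_w e)` for `j = (w, a, e)`. -/
noncomputable def kerPair (j : Ω × ℂ × E) : WithLp 2 (Hs × HkE) :=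
  WithLp.toLp 2 (RKHS.kerFun Hs j.1 j.2.1, RKHS.kerFun HkE j.1 j.2.2)

theorem inner_kerPair (j : Ω × ℂ × E) (x : WithLp 2 (Hs × HkE)) :
    inner ℂ (kerPair Hs HkE j) x
      = inner ℂ j.2.1 (x.fst j.1) + inner ℂ j.2.2 (x.snd j.1) := by
  rw [kerPair, WithLp.prod_inner_apply, ← RKHS.kerFun_inner, ← RKHS.kerFun_inner]
  rfl

theorem defectKernel_eq (hs : HasScalarKernel Hs s) (hk : HasScalarKernel HkE k)
    (i j : Ω × ℂ × E) :
    inner ℂ (kerPair Hs HkE i) (kerPair Hs HkE j)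
      - inner ℂ (RKHS.kerFun Hs i.1 (adjointCoeff ψ Φ i)) (RKHS.kerFun Hs j.1 (adjointCoeff ψ Φ j))
      = defectKernel s k ψ Φ i j := by
  rw [hs.inner_kerFun, kerPair, kerPair, WithLp.prod_inner_apply]
  change inner ℂ (RKHS.kerFun Hs i.1 i.2.1) (RKHS.kerFun Hs j.1 j.2.1)
    + inner ℂ (RKHS.kerFun HkE i.1 i.2.2) (RKHS.kerFun HkE j.1 j.2.2) - _ = _
  rw [hs.inner_kerFun, hk.inner_kerFun, defectKernel]
  simp only [RCLike.inner_apply]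
  ring

/-- Positivity yields a contraction sending each pair of kernel functions to its prescribed multiple
of `s_w`; its adjoint, evaluated pointwise, is multiplication by the column `(ψ, Φ)`. -/
theorem mult_of_posSemidef_defectKernel (hs : HasScalarKernel Hs s) (hk : HasScalarKernel HkE k)
    (hD : (Matrix.of (defectKernel s k ψ Φ)).PosSemidef) :
    scalarSymbol ℂ ψ ∈ Mult Hs Hs ∧ columnSymbol Φ ∈ Mult Hs HkE ∧
      ∀ h : Hs, ‖mulOp Hs Hs (scalarSymbol ℂ ψ) h‖ ^ 2
        + ‖mulOp Hs HkE (columnSymbol Φ) h‖ ^ 2 ≤ ‖h‖ ^ 2 := by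
  obtain ⟨T, hT, hTv⟩ := exists_contraction (kerPair Hs HkE)
    (fun i => RKHS.kerFun Hs i.1 (adjointCoeff ψ Φ i))
    (fun x hx => by
      simp only [inner_kerPair] at hx
      have h1 : x.fst = 0 := RKHS.ext fun z => by simpa using hx (z, 1, 0)
      have h2 : x.snd = 0 := RKHS.ext fun z => ext_inner_left ℂ fun e => by
        simpa using hx (z, 0, e)
      exact WithLp.ofLp_injective 2 (Prod.ext h1 h2))
    (by simpa only [defectKernel_eq hs hk] using hD)
  let M := ContinuousLinearMap.adjoint T
  have hM : ∀ (j : Ω × ℂ × E) h, inner ℂ j.2.1 ((M h).fst j.1) + inner ℂ j.2.2 ((M h).snd j.1)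
      = conj (adjointCoeff ψ Φ j) * h j.1 := fun j h => by
    rw [← inner_kerPair, ContinuousLinearMap.adjoint_inner_right, hTv, RKHS.kerFun_inner,
      RCLike.inner_apply, mul_comm]
  have h1 : ∀ h z, (M h).fst z = ψ z * h z := fun h z => by
    simpa [adjointCoeff] using hM (z, 1, 0) h
  have h2 : ∀ h z, (M h).snd z = h z • Φ z := fun h z => ext_inner_left ℂ fun e => by
    simpa [adjointCoeff, inner_smul_right, mul_comm] using hM (z, 0, e) h
  have m1 : scalarSymbol ℂ ψ ∈ Mult Hs Hs :=
    ⟨(WithLp.fstL 2 ℂ Hs HkE).comp M, fun f z => by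
      change (M f).fst z = _
      simp [h1, scalarSymbol]⟩
  have m2 : columnSymbol Φ ∈ Mult Hs HkE :=
    ⟨(WithLp.sndL 2 ℂ Hs HkE).comp M, fun f z => by
      change (M f).snd z = _
      simp [h2, columnSymbol]⟩
  refine ⟨m1, m2, fun h => ?_⟩
  have e1 : mulOp Hs Hs (scalarSymbol ℂ ψ) h = (M h).fst := RKHS.ext fun z => by
    rw [mulOp_apply m1, h1]; simp [scalarSymbol]
  have e2 : mulOp Hs HkE (columnSymbol Φ) h = (M h).snd := RKHS.ext fun z => by
    rw [mulOp_apply m2, h2]; simp [columnSymbol]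
  rw [e1, e2, ← WithLp.prod_norm_sq_eq_of_L2]
  exact pow_le_pow_left₀ (norm_nonneg _) (norm_adjoint_apply_le hT h) 2

theorem IsFactorization.posSemidef_defectKernel {z₀ : Ω} {F : Ω → E}
    (h : IsFactorization Hs HkE z₀ F ψ Φ)
    (hs : HasScalarKernel Hs s) (hk : HasScalarKernel HkE k) :
    (Matrix.of (defectKernel s k ψ Φ)).PosSemidef := by
  let M : Hs →L[ℂ] WithLp 2 (Hs × HkE) :=
    (WithLp.prodContinuousLinearEquiv 2 ℂ Hs HkE).symm.toContinuousLinearMap.comp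
      ((mulOp Hs Hs (scalarSymbol ℂ ψ)).prod (mulOp Hs HkE (columnSymbol Φ)))
  have hM1 : ∀ f, (M f).fst = mulOp Hs Hs (scalarSymbol ℂ ψ) f := fun _ => rfl
  have hM2 : ∀ f, (M f).snd = mulOp Hs HkE (columnSymbol Φ) f := fun _ => rfl
  have hM : ∀ f, ‖M f‖ ≤ ‖f‖ := fun f => by
    refine (sq_le_sq₀ (norm_nonneg _) (norm_nonneg _)).1 ?_
    rw [WithLp.prod_norm_sq_eq_of_L2, hM1, hM2]
    exact h.norm_le f
  have hv : ∀ j, ContinuousLinearMap.adjoint M (kerPair Hs HkE j)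
      = RKHS.kerFun Hs j.1 (adjointCoeff ψ Φ j) := fun j => by
    refine ext_inner_right ℂ fun f => ?_
    rw [ContinuousLinearMap.adjoint_inner_left, inner_kerPair, hM1, hM2,
      mulOp_apply h.mult_left, mulOp_apply h.mult_right, RKHS.kerFun_inner]
    simp [scalarSymbol, columnSymbol, adjointCoeff]
    ring
  have := posSemidef_inner_sub (kerPair Hs HkE) (ContinuousLinearMap.adjoint M)
    (norm_adjoint_apply_le hM)
  simpa only [hv, defectKernel_eq hs hk] using this

end Column

/-! ### From a factorization to the unit ball -/

section Realization

variable {Ω E : Type*} [NormedAddCommGroup E] [InnerProductSpace ℂ E] [CompleteSpace E]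
  {Hs : Type*} [NormedAddCommGroup Hs] [InnerProductSpace ℂ Hs] [CompleteSpace Hs]
  [RKHS ℂ Hs Ω ℂ]
  {HkE : Type*} [NormedAddCommGroup HkE] [InnerProductSpace ℂ HkE] [CompleteSpace HkE]
  [RKHS ℂ HkE Ω E]
  {s k : Ω → Ω → ℂ} {ψ : Ω → ℂ} {Φ : Ω → E} {z₀ : Ω} {F : Ω → E}

/-- If `ψ(z) = 1`, the Gram vector at `(z, 1, 0)` has norm zero, yet its inner product with the one
at `(z₀, 1, 0)` is `s z z₀ = 1`. -/
theorem IsFactorization.one_sub_ne_zero (h : IsFactorization Hs HkE z₀ F ψ Φ)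
    (hs : HasScalarKernel Hs s) (hk : HasScalarKernel HkE k)
    (hs₀ : ∀ z, s z z₀ = 1) (z : Ω) : 1 - ψ z ≠ 0 := by
  intro h0
  obtain ⟨G, _, _, _, v, hv⟩ := exists_gram (h.posSemidef_defectKernel hs hk)
  have h1 : ψ z = 1 := (sub_eq_zero.1 h0).symm
  have hz : inner ℂ (v (z, 1, 0)) (v (z, 1, 0)) = 0 := by
    rw [hv]; simp [defectKernel, adjointCoeff, h1]
  have hz₀ : inner ℂ (v (z, 1, 0)) (v (z₀, 1, 0)) = 1 := by
    rw [hv]; simp [defectKernel, adjointCoeff_base h.base_point, hs₀]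
  rw [inner_self_eq_zero.1 hz, inner_zero_left] at hz₀
  exact zero_ne_one hz₀

/-- If `F = Φ / (1 - ψ)` is a factorization, then `F` is in the unit ball of `H_k(E)`. If moreover
`‖F‖ = 1`, then `⟨F, s_w F⟩ = 1 / (1 - ψ(w))`. -/
theorem IsFactorization.exists_realization (h : IsFactorization Hs HkE z₀ F ψ Φ)
    (hs : HasScalarKernel Hs s) (hk : HasScalarKernel HkE k) (hs₀ : ∀ z, s z z₀ = 1) :
    ∃ f : HkE, ⇑f = F ∧ ‖f‖ ≤ 1 ∧ (‖f‖ = 1 → ∀ (w : Ω) (f' : HkE),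
      (∀ z, f' z = s z w • F z) → (1 - ψ w) * inner ℂ f' f = 1) := by
  obtain ⟨G, _, _, _, v, hv⟩ := exists_gram (h.posSemidef_defectKernel hs hk)
  have hΦ : ∀ z, Φ z = (1 - ψ z) • F z := fun z => by
    rw [h.eq_div z, smul_smul, mul_one_div_cancel (h.one_sub_ne_zero hs hk hs₀ z), one_smul]
  -- With the scalar entry `inner ℂ (F z) e` the coefficient reproduces that entry, so the `s`-term
  -- of the defect kernel cancels and only `k` remains.
  have hcoeff : ∀ z e, adjointCoeff ψ Φ (z, inner ℂ (F z) e, e) = inner ℂ (F z) e := fun z e => by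
    simp only [adjointCoeff, hΦ, inner_smul_left, map_sub, map_one]
    ring
  obtain ⟨V, hV, hVk⟩ := exists_contraction (fun i : Ω × E => RKHS.kerFun HkE i.1 i.2)
    (fun i => v (i.1, inner ℂ (F i.1) i.2, i.2))
    (fun x hx => eq_zero_of_inner_kerFun fun z e => hx (z, e)) (by
      have : (Matrix.of fun i j : Ω × E => inner ℂ (RKHS.kerFun HkE i.1 i.2)
          (RKHS.kerFun HkE j.1 j.2) - inner ℂ (v (i.1, inner ℂ (F i.1) i.2, i.2))
          (v (j.1, inner ℂ (F j.1) j.2, j.2))) = 0 := by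
        ext i j
        simp [hv, defectKernel, hcoeff, hk.inner_kerFun, -RKHS.kerFun_inner, -RKHS.inner_kerFun]
      rw [this]
      exact Matrix.PosSemidef.zero)
  -- At the base point the coefficient vanishes and `s w z₀ = 1`, so pairing with `γ` reads off the
  -- scalar entry.
  have hγ : ∀ w a e, inner ℂ (v (w, a, e)) (v (z₀, 1, 0)) = conj a := fun w a e => by
    rw [hv]; simp [defectKernel, adjointCoeff_base h.base_point, hs₀]
  have hγ1 : ‖v (z₀, 1, 0)‖ = 1 := by
    have := inner_self_eq_norm_sq (𝕜 := ℂ) (v (z₀, 1, 0))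
    rw [hγ, map_one, RCLike.one_re] at this
    exact (pow_eq_one_iff_of_nonneg (norm_nonneg _) two_ne_zero).1 this.symm
  set γ := v (z₀, 1, 0)
  have hf : ⇑(ContinuousLinearMap.adjoint V γ) = F := by
    ext1 z
    refine ext_inner_left ℂ fun e => ?_
    rw [← RKHS.kerFun_inner, ContinuousLinearMap.adjoint_inner_right]
    rw [hVk (z, e), hγ, inner_conj_symm]
  refine ⟨ContinuousLinearMap.adjoint V γ, hf, (norm_adjoint_apply_le hV γ).trans_eq hγ1,
    fun h1 w f' hf' => ?_⟩
  set f := ContinuousLinearMap.adjoint V γ with hfdef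
  -- Equality case of Cauchy–Schwarz: `Re ⟨γ, V f⟩ = ‖f‖² = 1` while `‖γ‖ = 1` and `‖V f‖ ≤ 1`.
  have hVf : γ = V f := by
    have e1 : RCLike.re (inner ℂ γ (V f)) = 1 := by
      rw [← ContinuousLinearMap.adjoint_inner_left, ← hfdef, inner_self_eq_norm_sq, h1, one_pow]
    have e2 := norm_sub_sq (𝕜 := ℂ) γ (V f)
    rw [e1, hγ1] at e2
    have e3 : ‖V f‖ ^ 2 ≤ 1 := by
      have := pow_le_pow_left₀ (norm_nonneg _) (hV f) 2
      rwa [h1, one_pow] at this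
    have e4 : ‖γ - V f‖ ^ 2 = 0 := le_antisymm (by linarith) (sq_nonneg _)
    exact sub_eq_zero.1 (norm_eq_zero.1 (pow_eq_zero_iff two_ne_zero |>.1 e4))
  have e : ContinuousLinearMap.adjoint V (v (w, 1, 0)) = conj (1 - ψ w) • f' := by
    refine RKHS.ext fun z => ext_inner_left ℂ fun e => ?_
    rw [← RKHS.kerFun_inner, ContinuousLinearMap.adjoint_inner_right, hVk (z, e), hv,
      RKHS.coe_smul, Pi.smul_apply, hf', inner_smul_right, inner_smul_right, defectKernel, hcoeff,
      inner_conj_symm]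
    simp only [adjointCoeff, inner_zero_right, map_sub, map_one]
    ring
  have := hγ w 1 0
  rwa [hVf, ← ContinuousLinearMap.adjoint_inner_left, e, inner_smul_left, Complex.conj_conj,
    map_one] at this

end Realization

/-! ### Multiplication by kernel functions -/

section KernelMultiplier

variable {Ω E : Type*} [NormedAddCommGroup E] [InnerProductSpace ℂ E] [CompleteSpace E]
  {H : Type*} [NormedAddCommGroup H] [InnerProductSpace ℂ H] [CompleteSpace H] [RKHS ℂ H Ω E]
  {s k p g : Ω → Ω → ℂ}

variable (H) in
/-- The Gram kernel of the vectors `(conj u(w) ⊗ η, g_w e)`, where `p_w(z) = u(z) conj u(w)`. -/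
noncomputable def stateKernel (p g : Ω → Ω → ℂ) (i j : Ω × H × E) : ℂ :=
  p i.1 j.1 * inner ℂ i.2.1 j.2.1 + g i.1 j.1 * inner ℂ i.2.2 j.2.2

omit [CompleteSpace E] [CompleteSpace H] [RKHS ℂ H Ω E] in
theorem posSemidef_stateKernel (hp : (Matrix.of p).PosSemidef) (hg : (Matrix.of g).PosSemidef) :
    (Matrix.of (stateKernel (E := E) H p g)).PosSemidef := by
  have h1 := (hp.submatrix fun i : Ω × H × E => i.1).hadamard
    (posSemidef_inner fun i : Ω × H × E => i.2.1)
  have h2 := (hg.submatrix fun i : Ω × H × E => i.1).hadamard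
    (posSemidef_inner fun i : Ω × H × E => i.2.2)
  have h3 := h1.add h2
  convert! h3 using 1

/-- If `k = p k + g`, then the row `(conj u(w) ⊗ η, g_w e) ↦ p_w η + g_w e` is a contraction into
`H_k(E)`. -/
theorem exists_row_contraction (hk : HasScalarKernel H k) (hp : (Matrix.of p).PosSemidef)
    (hg : (Matrix.of g).PosSemidef) (hkpg : ∀ z w, k z w = p z w * k z w + g z w) :
    ∃ Y : Ω × H × E → H,
      (∀ j x, Y j x = p x j.1 • j.2.1 x + g x j.1 • j.2.2) ∧
      (Matrix.of fun i j => stateKernel H p g i j - inner ℂ (Y i) (Y j)).PosSemidef := by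
  obtain ⟨G, _, _, _, v, hv⟩ := exists_gram (posSemidef_stateKernel (E := E) (H := H) hp hg)
  -- The identity `k = p k + g` says that this map preserves Gram matrices; the row sought is its
  -- adjoint.
  obtain ⟨ι, hι, hιk⟩ := exists_contraction (fun i : Ω × E => RKHS.kerFun H i.1 i.2)
    (fun i => v (i.1, RKHS.kerFun H i.1 i.2, i.2))
    (fun x hx => eq_zero_of_inner_kerFun fun z e => hx (z, e)) (by
      have : (Matrix.of fun i j : Ω × E => inner ℂ (RKHS.kerFun H i.1 i.2)
          (RKHS.kerFun H j.1 j.2) - inner ℂ (v (i.1, RKHS.kerFun H i.1 i.2, i.2))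
          (v (j.1, RKHS.kerFun H j.1 j.2, j.2))) = 0 := by
        ext i j
        simp only [Matrix.of_apply, hv, stateKernel, hk.inner_kerFun, Matrix.zero_apply]
        linear_combination inner ℂ i.2 j.2 * hkpg i.1 j.1
      rw [this]
      exact Matrix.PosSemidef.zero)
  refine ⟨fun j => ContinuousLinearMap.adjoint ι (v j), fun j x => ?_, ?_⟩
  · refine ext_inner_left ℂ fun e => ?_
    rw [← RKHS.kerFun_inner, ContinuousLinearMap.adjoint_inner_right, hιk (x, e), hv]
    simp [stateKernel, inner_add_right, inner_smul_right]
  · simpa only [hv] using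
      posSemidef_inner_sub v (ContinuousLinearMap.adjoint ι) (norm_adjoint_apply_le hι)

/-- If `k = p k + g` and `p_w(w) < 1`, then multiplication by `p_w` is a strict contraction on
`H_k(E)`. -/
theorem exists_mul_norm_lt_one (hk : HasScalarKernel H k) (hp : (Matrix.of p).PosSemidef)
    (hg : (Matrix.of g).PosSemidef) (hkpg : ∀ z w, k z w = p z w * k z w + g z w) {w : Ω}
    (hpw : (p w w).re < 1) :
    ∃ M : H →L[ℂ] H, (∀ f z, M f z = p z w • f z) ∧ ‖M‖ < 1 := by
  obtain ⟨Y, hY, hPY⟩ := exists_row_contraction hk hp hg hkpg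
  have hY0 : ∀ f z, Y (w, f, 0) z = p z w • f z := fun f z => by simp [hY]
  let L : H →ₗ[ℂ] H :=
    { toFun := fun f => Y (w, f, 0)
      map_add' := fun f f' => RKHS.ext fun z => by simp [hY0]
      map_smul' := fun c f => RKHS.ext fun z => by simp [hY0, smul_comm (p z w)] }
  have hL : ∀ f, ‖L f‖ ≤ √(p w w).re * ‖f‖ := fun f => by
    have h1 := (Complex.le_def.1 (hPY.diag_nonneg (i := (w, f, 0)))).1
    simp only [Matrix.of_apply, stateKernel, inner_zero_left, mul_zero, add_zero,
      inner_self_eq_ofReal, Complex.sub_re, Complex.zero_re, Complex.re_mul_ofReal,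
      Complex.ofReal_re, sub_nonneg] at h1
    have h0 : 0 ≤ (p w w).re := (Complex.le_def.1 (hp.diag_nonneg (i := w))).1
    refine abs_le_of_sq_le_sq' ?_ (by positivity) |>.2
    rw [mul_pow, Real.sq_sqrt h0]
    exact h1
  refine ⟨L.mkContinuous _ hL, hY0, (L.mkContinuous_norm_le (Real.sqrt_nonneg _) hL).trans_lt ?_⟩
  rw [Real.sqrt_lt' one_pos]
  simpa using hpw

/-- If `s = 1 / (1 - p)`, `k = p k + g` and `p_w(w) < 1`, then `s_w` is a multiplier of `H_k(E)`,
and `2 s_w - 1` has positive real part as an operator. -/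
theorem exists_mul_kernel (hk : HasScalarKernel H k) (hp : (Matrix.of p).PosSemidef)
    (hg : (Matrix.of g).PosSemidef) (hkpg : ∀ z w, k z w = p z w * k z w + g z w)
    (hsp : ∀ z w, s z w * (1 - p z w) = 1) {w : Ω} (hpw : (p w w).re < 1) :
    ∃ S : H →L[ℂ] H, (∀ f z, S f z = s z w • f z) ∧ ∀ f, ‖f‖ ^ 2 ≤ 2 * (inner ℂ (S f) f).re := by
  obtain ⟨M, hM, hM1⟩ := exists_mul_norm_lt_one hk hp hg hkpg hpw
  obtain ⟨S, hS⟩ := (isUnit_one_sub_of_norm_lt_one hM1).exists_right_inv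
  have hSf : ∀ f, S f - M (S f) = f := fun f => by
    simpa using congrArg (fun T : H →L[ℂ] H => T f) hS
  refine ⟨S, fun f z => ?_, fun f => ?_⟩
  · have h1 : S f z - p z w • S f z = f z := by
      rw [← hM, ← Pi.sub_apply, ← RKHS.coe_sub, hSf]
    have h2 : f z = (1 - p z w) • S f z := by rw [← h1, sub_smul, one_smul]
    rw [h2, smul_smul, hsp, one_smul]
  -- Put `h = S f`, so `f = h - M h`. Expanding `‖h - M h‖²` and using `‖M h‖ ≤ ‖h‖` bounds it by `2
  -- Re ⟨h, h - M h⟩`.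
  · have h1 := norm_sub_sq (𝕜 := ℂ) (S f) (M (S f))
    have h2 : (inner ℂ (S f) f).re = ‖S f‖ ^ 2 - (inner ℂ (S f) (M (S f))).re := by
      conv_lhs => rw [← hSf f, hSf f]
      nth_rewrite 2 [← hSf f]
      rw [inner_sub_right, Complex.sub_re, ← inner_self_eq_norm_sq (𝕜 := ℂ)]
      rfl
    rw [hSf] at h1
    have h3 : ‖M (S f)‖ ^ 2 ≤ ‖S f‖ ^ 2 := by
      refine pow_le_pow_left₀ (norm_nonneg _) ?_ 2
      simpa using M.le_of_opNorm_le hM1.le (S f)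
    simp only [RCLike.re_to_complex] at h1
    linarith

end KernelMultiplier

/-! ### From the unit ball to a factorization -/

section Factorization

variable {Ω E : Type*} [NormedAddCommGroup E] [InnerProductSpace ℂ E] [CompleteSpace E]
  {H : Type*} [NormedAddCommGroup H] [InnerProductSpace ℂ H] [CompleteSpace H] [RKHS ℂ H Ω E]
  {s k p g : Ω → Ω → ℂ}

/-- With `Y` the row contraction, the defect kernel is `s` times (defect of `Y` at `ξ`, plus `(1 -
‖f‖²) conj(d_i) d_j`), plus the Gram matrix of `η`. Each summand is positive by the Schur product
theorem. The vectors `η` are chosen so that `Y` moves them only along `f`. -/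
theorem posSemidef_defectKernel (hk : HasScalarKernel H k) (hs : (Matrix.of s).PosSemidef)
    (hp : (Matrix.of p).PosSemidef)
    (hg : (Matrix.of g).PosSemidef) (hkpg : ∀ z w, k z w = p z w * k z w + g z w)
    (hsp : ∀ z w, s z w * (1 - p z w) = 1) (f : H) (hf : ‖f‖ ≤ 1) (S : Ω → H)
    (hS : ∀ w z, S w z = s z w • f z) {A : Ω → ℂ}
    (hA : ∀ w, A w = inner ℂ (S w) f + 1 - inner ℂ f f) (hA0 : ∀ w, A w ≠ 0) :
    (Matrix.of (defectKernel s k (fun w => 1 - 1 / A w)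
      fun w => (1 / A w) • f w)).PosSemidef := by
  obtain ⟨Y, hY, hPY⟩ := exists_row_contraction hk hp hg hkpg
  set c := adjointCoeff (fun w => 1 - 1 / A w) fun w => (1 / A w) • f w with hcdef
  let η : Ω × ℂ × E → H := fun j => RKHS.kerFun H j.1 j.2.2 + (j.2.1 - c j) • S j.1
  let ξ : Ω × ℂ × E → Ω × H × E := fun j => (j.1, η j, j.2.2)
  let d : Ω × ℂ × E → ℂ := fun j => c j - j.2.1
  -- The defining equation of `c` cleared of denominators; it is what makes `⟨Y(ξ_j), f⟩` collapse
  -- to `c` in `hfy`.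
  have hc : ∀ j, c j * conj (A j.1) = (conj (A j.1) - 1) * j.2.1 + inner ℂ (f j.1) j.2.2 := by
    intro j
    have : conj (A j.1) ≠ 0 := by simpa using hA0 j.1
    simp only [hcdef, adjointCoeff, inner_smul_left, map_sub, map_div₀, map_one]
    field_simp
  have hy : ∀ j, Y (ξ j) = η j + d j • f := fun j => RKHS.ext fun x => by
    have e1 : η j x = k x j.1 • j.2.2 + (j.2.1 - c j) • s x j.1 • f x := by
      simp [η, hS, hk.kerFun_apply]
    have e2 : k x j.1 - p x j.1 * k x j.1 = g x j.1 := by linear_combination hkpg x j.1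
    have e3 : s x j.1 - p x j.1 * s x j.1 = 1 := by linear_combination hsp x j.1
    rw [hY]
    simp only [ξ, d, RKHS.coe_add, RKHS.coe_smul, Pi.add_apply, Pi.smul_apply]
    rw [e1, ← e2]
    have e4 : f x = (s x j.1 - p x j.1 * s x j.1) • f x := by rw [e3, one_smul]
    rw [show (c j - j.2.1) • f x = (c j - j.2.1) • (s x j.1 - p x j.1 * s x j.1) • f x by
      rw [← e4]]
    module
  have hfy : ∀ j, inner ℂ f (Y (ξ j)) = c j := fun j => by
    have e1 : inner ℂ f (S j.1) = conj (A j.1) - 1 + inner ℂ f f := by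
      rw [hA]
      simp only [map_add, map_sub, map_one, inner_conj_symm]
      ring
    rw [hy]
    simp only [η, d, inner_add_right, inner_smul_right, e1, RKHS.inner_kerFun]
    linear_combination -hc j
  have hyf : ∀ j, inner ℂ (Y (ξ j)) f = conj (c j) := fun j => by
    rw [← hfy, inner_conj_symm]
  have hηη : ∀ i j, inner ℂ (η i) (η j) = inner ℂ (Y (ξ i)) (Y (ξ j)) - d j * conj (c i)
      - conj (d i) * c j + conj (d i) * d j * inner ℂ f f := fun i j => by
    have e : ∀ j, η j = Y (ξ j) - d j • f := fun j => by rw [hy, add_sub_cancel_right]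
    rw [e i, e j]
    simp only [inner_sub_left, inner_sub_right, inner_smul_left, inner_smul_right, hfy, hyf]
    ring
  have hN : (0 : ℂ) ≤ 1 - inner ℂ f f := by
    rw [inner_self_eq_ofReal]
    have : (0 : ℝ) ≤ 1 - ‖f‖ ^ 2 := by nlinarith [norm_nonneg f]
    exact_mod_cast this
  have key := ((hs.submatrix fun j : Ω × ℂ × E => j.1).hadamard
    ((hPY.submatrix ξ).add ((posSemidef_conj_mul d).smul hN))).add (posSemidef_inner η)
  convert! key using 1
  ext i j
  simp only [Matrix.of_apply, Matrix.add_apply, Matrix.hadamard_apply, Matrix.submatrix_apply,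
    Matrix.smul_apply, smul_eq_mul, defectKernel, stateKernel]
  rw [← hcdef]
  have hη := hηη i j
  simp only [d, map_sub] at hη
  simp only [ξ, d, map_sub] at hη ⊢
  linear_combination (s i.1 j.1 * hkpg i.1 j.1 - k i.1 j.1 * hsp i.1 j.1) * inner ℂ i.2.2 j.2.2
    + inner ℂ (η i) (η j) * hsp i.1 j.1 - s i.1 j.1 * hη

end Factorization

/-- The sum `p = ∑ u_n(z) conj(u_n(w))` is a Gram kernel in `ℓ²`. The vectors are conjugated because
`inner` is conjugate linear in its first slot. On the diagonal, `s ≥ 0` and `s (1 - p) = 1` exclude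
`p ≥ 1`. -/
theorem IsNormalizedCNP.exists_gram_kernel {Ω : Type*} {z₀ : Ω} {s : Ω → Ω → ℂ}
    (h : IsNormalizedCNP z₀ s) :
    ∃ p : Ω → Ω → ℂ, (Matrix.of p).PosSemidef ∧ (∀ z w, s z w * (1 - p z w) = 1) ∧
      (∀ z, p z z₀ = 0) ∧ ∀ z, (p z z).re < 1 := by
  obtain ⟨hs, u, hu0, hu, hsu⟩ := h
  have hmem : ∀ z, Memℓp (fun n => conj (u n z)) 2 := fun z => by
    refine memℓp_gen ?_
    simpa using hu z
  let v : Ω → lp (fun _ : ℕ => ℂ) 2 := fun z => ⟨fun n => conj (u n z), hmem z⟩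
  have hv : ∀ z w, inner ℂ (v z) (v w) = ∑' n, u n z * conj (u n w) := fun z w => by
    rw [lp.inner_eq_tsum]
    refine tsum_congr fun n => ?_
    simp [v, mul_comm]
  have hsp : ∀ z w, s z w * (1 - inner ℂ (v z) (v w)) = 1 := fun z w => by
    rw [hv, (hsu z w).2, one_div_mul_cancel (hsu z w).1]
  refine ⟨fun z w => inner ℂ (v z) (v w), posSemidef_inner v, hsp, fun z => ?_, fun z => ?_⟩
  · simp [hv, hu0]
  · have h0 := hs.diag_nonneg (i := z)
    have h1 := hsp z z
    change (inner ℂ (v z) (v z)).re < 1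
    rw [inner_self_eq_ofReal] at h1 ⊢
    rw [Complex.ofReal_re]
    by_contra! h2
    have h4 := congrArg Complex.re h1
    have h5 : 0 ≤ (s z z).re := (Complex.le_def.1 h0).1
    have h6 : (s z z * (1 - ((‖v z‖ ^ 2 : ℝ) : ℂ))).re = (s z z).re * (1 - ‖v z‖ ^ 2) := by
      rw [← Complex.ofReal_one, ← Complex.ofReal_sub, Complex.re_mul_ofReal]
    rw [h6, Complex.one_re] at h4
    nlinarith

end CNP

theorem theorem1p1 {Ω : Type*}
    {E : Type*} [NormedAddCommGroup E] [InnerProductSpace ℂ E] [CompleteSpace E]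
    [TopologicalSpace.SeparableSpace E]
    {Hs : Type*} [NormedAddCommGroup Hs] [InnerProductSpace ℂ Hs] [CompleteSpace Hs]
    [RKHS ℂ Hs Ω ℂ]
    {HkE : Type*} [NormedAddCommGroup HkE] [InnerProductSpace ℂ HkE] [CompleteSpace HkE]
    [RKHS ℂ HkE Ω E]
    (z₀ : Ω) (s g k : Ω → Ω → ℂ)
    (hs : CNP.IsNormalizedCNP z₀ s)
    (hg : (Matrix.of g).PosSemidef)
    (hk : ∀ z w, k z w = s z w * g z w)
    (hHs : CNP.HasScalarKernel Hs s)
    (hHkE : CNP.HasScalarKernel HkE k) :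
    -- the quotient `Φ / (1 - ψ)` is always a genuine one
    (∀ (F : Ω → E) (ψ : Ω → ℂ) (Φ : Ω → E),
      CNP.IsFactorization Hs HkE z₀ F ψ Φ → ∀ z, 1 - ψ z ≠ 0) ∧
    -- (i)
    (∀ F : Ω → E,
      (∃ f : HkE, ⇑f = F ∧ ‖f‖ ≤ 1) ↔
        ∃ (ψ : Ω → ℂ) (Φ : Ω → E), CNP.IsFactorization Hs HkE z₀ F ψ Φ) ∧
    -- (ii)
    (∀ w, CNP.scalarSymbol E (fun z => s z w) ∈ CNP.Mult HkE HkE) ∧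
    (∀ F : HkE, ‖F‖ = 1 →
      (∃! p : (Ω → ℂ) × (Ω → E), CNP.IsFactorization Hs HkE z₀ F p.1 p.2) ∧
      (∀ z, 0 ≤ (CNP.sarason s F z).re) ∧
      CNP.IsFactorization Hs HkE z₀ F
        (fun z => (CNP.sarason s F z - 1) / (CNP.sarason s F z + 1))
        (fun z => (2 / (CNP.sarason s F z + 1)) • F z)) := by

  obtain ⟨p, hp, hsp, hp₀, hpw⟩ := hs.exists_gram_kernel
  have hs₀ : ∀ z, s z z₀ = 1 := fun z => by simpa [hp₀] using hsp z z₀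
  have hkpg : ∀ z w, k z w = p z w * k z w + g z w := fun z w => by
    rw [hk]
    linear_combination g z w * hsp z w
  choose S hS hSre using fun w =>
    CNP.exists_mul_kernel hHkE hp hg hkpg hsp (hpw w)
  have hmult : ∀ w, CNP.scalarSymbol E (fun z => s z w) ∈ CNP.Mult HkE HkE :=
    fun w => ⟨S w, fun f z => by simp [hS, CNP.scalarSymbol]⟩
  have hmulOp : ∀ w f, CNP.mulOp HkE HkE (CNP.scalarSymbol E fun z => s z w) f = S w f :=
    fun w f => RKHS.ext fun z => by
      rw [CNP.mulOp_apply (hmult w), hS]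
      rfl
  -- every `f` in the unit ball has a factorization
  have hfac : ∀ f : HkE, ‖f‖ ≤ 1 → ∀ A : Ω → ℂ,
      (∀ w, A w = inner ℂ (S w f) f + 1 - inner ℂ f f) →
      CNP.IsFactorization Hs HkE z₀ f (fun w => 1 - 1 / A w) (fun w => (1 / A w) • f w) := by
    intro f hf A hA
    -- `Re A(w) ≥ ‖f‖²/2 + 1 - ‖f‖² > 0`.
    have hA0 : ∀ w, A w ≠ 0 := fun w h0 => by
      have h1 := congrArg Complex.re (hA w)
      rw [h0, CNP.inner_self_eq_ofReal] at h1
      simp only [Complex.zero_re, Complex.sub_re, Complex.add_re, Complex.one_re,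
        Complex.ofReal_re] at h1
      nlinarith [hSre w f, norm_nonneg f]
    obtain ⟨h1, h2, h3⟩ := CNP.mult_of_posSemidef_defectKernel (Hs := Hs) hHs hHkE
      (CNP.posSemidef_defectKernel hHkE hs.1 hp hg hkpg hsp f hf (fun w => S w f)
        (fun w z => hS w f z) hA hA0)
    refine ⟨h1, ?_, h2, h3, fun z => ?_⟩
    -- The summand `1 - ‖f‖²` in `A` normalizes `A(z₀) = 1`, that is `ψ(z₀) = 0`, also when `‖f‖ <
    -- 1`.
    · have h4 : S z₀ f = f := RKHS.ext fun z => by rw [hS, hs₀, one_smul]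
      simp [hA, h4]
    · rw [sub_sub_cancel, smul_smul, one_div_mul_cancel (one_div_ne_zero (hA0 z)), one_smul]
  refine ⟨fun F ψ Φ h => h.one_sub_ne_zero hHs hHkE hs₀, fun F => ⟨?_, ?_⟩, hmult,
    fun F hF => ?_⟩
  · rintro ⟨f, rfl, hf⟩
    exact ⟨_, _, hfac f hf _ fun _ => rfl⟩
  · rintro ⟨ψ, Φ, h⟩
    obtain ⟨f, h1, h2, -⟩ := h.exists_realization hHs hHkE hs₀
    exact ⟨f, h1, h2⟩
  · have hsar : ∀ z, CNP.sarason s F z = 2 * inner ℂ (S z F) F - 1 := fun z => by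
      rw [CNP.sarason, hmulOp]
    have hFF : inner ℂ F F = 1 := by
      rw [CNP.inner_self_eq_ofReal, hF]
      simp
    have hre : ∀ z, 0 ≤ (CNP.sarason s F z).re := fun z => by
      have := hSre z F
      rw [hF] at this
      rw [hsar]
      simp only [Complex.sub_re, Complex.one_re, Complex.re_ofNat, Complex.mul_re,
        Complex.im_ofNat, zero_mul, sub_zero]
      linarith
    have hV : ∀ z, CNP.sarason s F z + 1 ≠ 0 := fun z h0 => by
      have h1 := congrArg Complex.re h0
      simp only [Complex.add_re, Complex.one_re, Complex.zero_re] at h1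
      linarith [hre z]
    have hex : CNP.IsFactorization Hs HkE z₀ F
        (fun z => (CNP.sarason s F z - 1) / (CNP.sarason s F z + 1))
        (fun z => (2 / (CNP.sarason s F z + 1)) • F z) := by
      -- For `‖F‖ = 1` the correction `1 - ‖F‖²` vanishes and `A = (V_F + 1) / 2`.
      convert! hfac F hF.le (fun z => (CNP.sarason s F z + 1) / 2)
        (fun z => by rw [hsar, hFF]; ring) using 2 with z z
      · have := hV z
        field_simp
        ring
      · rw [one_div_div]
    refine ⟨⟨(_, _), hex, ?_⟩, hre, hex⟩
    have huniq : ∀ (ψ : Ω → ℂ) (Φ : Ω → E), CNP.IsFactorization Hs HkE z₀ F ψ Φ →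
        (∀ w, 1 - ψ w = (inner ℂ (S w F) F)⁻¹) ∧ ∀ w, Φ w = (1 - ψ w) • F w := by
      intro ψ Φ h
      refine ⟨fun w => ?_, fun w => ?_⟩
      · obtain ⟨f, h1, -, h2⟩ := h.exists_realization hHs hHkE hs₀
        obtain rfl : f = F := DFunLike.coe_injective h1
        exact eq_inv_of_mul_eq_one_left (h2 hF w (S w f) (hS w f))
      · rw [h.eq_div w, smul_smul, mul_one_div_cancel (h.one_sub_ne_zero hHs hHkE hs₀ w),
          one_smul]
    rintro ⟨ψ, Φ⟩ h
    obtain ⟨h1, h2⟩ := huniq ψ Φ h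
    obtain ⟨h3, h4⟩ := huniq _ _ hex
    have h5 : ∀ w, ψ w = (CNP.sarason s F w - 1) / (CNP.sarason s F w + 1) := fun w =>
      sub_right_injective ((h1 w).trans (h3 w).symm)
    refine Prod.ext (funext h5) (funext fun w => ?_)
    change Φ w = _
    rw [h2, h5, ← h4]
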